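/- Let $0 < \beta \le \kappa < 1$ and let $f : \mathbb{R} \to \mathbb{R}$ be the function of period $1$ with $f(x) = x$ for $0 \le x < \kappa$ and $f(x) = x - \beta$ for $\kappa \le x < 1$. For $\alpha \in \mathbb{R}$ and $N \in \mathbb{N}$, let $s_1 < s_2 < \dots < s_n$ be the distinct values of $f(d\alpha)$, $1 \le d \le N$, and let $$G_{f,\alpha,N} = \{\, s_1 - \inf f + \sup f - s_n \,\} \cup \{\, s_{j+1} - s_j : 1 \le j < n \,\}$$ be the gap length set of $f$ associated with $\alpha$ and $N$ (empty if $N = 0$). Then for all $\alpha \in \mathbb{R}$ and $N \in \mathbb{N}$, $$|G_{f,\alpha,N}| \le 10.$$ -/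

import Mathlib

/-- The set of values `f (d α)`, `1 ≤ d ≤ N`. -/
def orbitValues (f : ℝ → ℝ) (α : ℝ) (N : ℕ) : Set ℝ :=
  {y | ∃ d : ℕ, 1 ≤ d ∧ d ≤ N ∧ f (d * α) = y}

/-- The gap length set of a bounded periodic function `f` associated with `α` and `N`.
If `s₁ < ⋯ < sₙ` are the distinct values `f (d α)`, `1 ≤ d ≤ N`, it consists of
`s₁ - inf f + sup f - sₙ` and of the differences `s_{j+1} - s_j` of consecutive values. -/
def gapLengthSet (f : ℝ → ℝ) (α : ℝ) (N : ℕ) : Set ℝ :=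
  {g | ∃ s t : ℝ, IsLeast (orbitValues f α N) s ∧ IsGreatest (orbitValues f α N) t ∧
      g = s - sInf (Set.range f) + sSup (Set.range f) - t} ∪
  {g | ∃ s ∈ orbitValues f α N, ∃ t ∈ orbitValues f α N, s < t ∧
      (∀ u ∈ orbitValues f α N, ¬(s < u ∧ u < t)) ∧ g = t - s}

/-!
Reduce the multiples `d * α` modulo `1`, obtaining points `p ∈ [0, 1)`. The values of `f` are the
points `p < κ` (the *lower branch*) and the points `p - β` with `κ ≤ p` (the *upper branch*). A gap
is the difference of two consecutive values, and there are five sources of gap lengths.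

* Both ends lie on the same branch. Then the gap is a gap between consecutive points `p`, and the
  classical three gap theorem gives at most `3` lengths.
* The ends lie on different branches, and the gap contains neither of the levels `κ - β` and
  `min κ (1 - β)` at which the set of overlapping branches changes. These give at most `4` lengths.
* A gap containing `κ - β`, a gap containing `min κ (1 - β)`, and the gap that closes up the circle
  give at most one length each.

The bounds `3` and `4` come from one parity argument. A gap with ends of indices `d` and `e` has
length `|v|` with `v = k * α + n - γ`, where `k = ±(e - d)`, `n` is an integer, and `γ` is `0` for
ends on the same branch and `β` for ends on different branches. That no value lies inside the gap
means: no offset `k' * α + n' - γ` with `|2 * k' - k| < N` lies strictly between `0` and `v`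
(`IsGapVector`). If two such vectors `(k, n)` are congruent modulo `2`, their midpoint is again an
integer vector, its offset is the mean of the two offsets, and it would lie strictly between `0` and
the longer of the two unless they have the same length (`IsGapVector.abs_offset_eq`). Hence there is
at most one length per class in `(ℤ / 2ℤ)²`, which is at most `4`; when `γ = 0` the zero class is
excluded by the same argument applied to the vector and the origin, which leaves `3`.
-/

/-! ### Gap vectors and their parity -/

/-- The signed distance `k * α + n - γ` attached to the integer vector `(k, n)`. -/
def offset (α γ : ℝ) (k n : ℤ) : ℝ := k * α + n - γ

/-- The vector `(k, n)` is a gap vector if `|k| < N` and no vector `(k', n')` whose first coordinate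
is within `N / 2` of `k / 2` has its offset strictly between `0` and the offset of `(k, n)`. -/
def IsGapVector (α γ : ℝ) (N : ℕ) (k n : ℤ) : Prop :=
  |k| < N ∧ ∀ k' n' : ℤ, |2 * k' - k| < N →
    ¬ (0 < offset α γ k' n' ∧ offset α γ k' n' < offset α γ k n) ∧
    ¬ (offset α γ k n < offset α γ k' n' ∧ offset α γ k' n' < 0)

/-- The class of an integer vector modulo `2`. -/
def parityClass (k n : ℤ) : ZMod 2 × ZMod 2 := (k, n)

lemma exists_add_two_mul_of_parityClass_eq {k n k' n' : ℤ}
    (h : parityClass k n = parityClass k' n') :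
    ∃ i j : ℤ, k' = k + 2 * i ∧ n' = n + 2 * j := by
  obtain ⟨h₁, h₂⟩ := Prod.ext_iff.mp h
  obtain ⟨i, hi⟩ := (ZMod.intCast_eq_intCast_iff_dvd_sub k k' 2).mp h₁
  obtain ⟨j, hj⟩ := (ZMod.intCast_eq_intCast_iff_dvd_sub n n' 2).mp h₂
  push_cast at hi hj
  exact ⟨i, j, by omega, by omega⟩

/-- The midpoint argument: of two congruent gap vectors, neither is longer than the other. -/
lemma IsGapVector.abs_offset_le {α γ : ℝ} {N : ℕ} {k n k' n' : ℤ}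
    (h : IsGapVector α γ N k n) (hk' : |k'| < N)
    (hpar : parityClass k n = parityClass k' n') :
    |offset α γ k n| ≤ |offset α γ k' n'| := by
  obtain ⟨i, j, rfl, rfl⟩ := exists_add_two_mul_of_parityClass_eq hpar
  by_contra! hlt
  have hmid : offset α γ (k + i) (n + j) =
      (offset α γ k n + offset α γ (k + 2 * i) (n + 2 * j)) / 2 := by
    simp only [offset]; push_cast; ring
  obtain ⟨hpos, hneg⟩ := h.2 (k + i) (n + j) (by rwa [show 2 * (k + i) - k = k + 2 * i by ring])
  rw [hmid] at hpos hneg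
  have h₁ := neg_abs_le (offset α γ (k + 2 * i) (n + 2 * j))
  have h₂ := le_abs_self (offset α γ (k + 2 * i) (n + 2 * j))
  rcases le_or_gt 0 (offset α γ k n) with h0 | h0
  · rw [abs_of_nonneg h0] at hlt
    exact hpos ⟨by linarith, by linarith⟩
  · rw [abs_of_neg h0] at hlt
    exact hneg ⟨by linarith, by linarith⟩

lemma IsGapVector.abs_offset_eq {α γ : ℝ} {N : ℕ} {k n k' n' : ℤ}
    (h : IsGapVector α γ N k n) (h' : IsGapVector α γ N k' n')
    (hpar : parityClass k n = parityClass k' n') :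
    |offset α γ k n| = |offset α γ k' n'| :=
  le_antisymm (h.abs_offset_le h'.1 hpar) (h'.abs_offset_le h.1 hpar.symm)

/-- The lengths of the nonzero gap vectors. -/
def gapVectorLengths (α γ : ℝ) (N : ℕ) : Set ℝ :=
  {g | 0 < g ∧ ∃ k n : ℤ, IsGapVector α γ N k n ∧ |offset α γ k n| = g}

lemma encard_gapVectorLengths_le_of_parityClass_mem {α γ : ℝ} {N : ℕ} (T : Set (ZMod 2 × ZMod 2))
    (hT : ∀ k n, IsGapVector α γ N k n → 0 < |offset α γ k n| → parityClass k n ∈ T) :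
    (gapVectorLengths α γ N).encard ≤ T.encard := by
  have hex : ∀ g : ℝ, ∃ c : ZMod 2 × ZMod 2, g ∈ gapVectorLengths α γ N →
      c ∈ T ∧ ∃ k n : ℤ, IsGapVector α γ N k n ∧ |offset α γ k n| = g ∧ parityClass k n = c := by
    intro g
    by_cases hg : g ∈ gapVectorLengths α γ N
    · obtain ⟨h0, k, n, hv, rfl⟩ := hg
      exact ⟨parityClass k n, fun _ => ⟨hT k n hv h0, k, n, hv, rfl, rfl⟩⟩
    · exact ⟨0, fun h => absurd h hg⟩
  choose c hc using hex
  refine Set.encard_le_encard_of_injOn (f := c) (fun g hg => (hc g hg).1) ?_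
  intro g hg g' hg' heq
  obtain ⟨-, k, n, hv, rfl, hp⟩ := hc g hg
  obtain ⟨-, k', n', hv', rfl, hp'⟩ := hc g' hg'
  exact hv.abs_offset_eq hv' (by rw [hp, hp', heq])

lemma encard_gapVectorLengths_le_four (α γ : ℝ) (N : ℕ) :
    (gapVectorLengths α γ N).encard ≤ 4 := by
  refine (encard_gapVectorLengths_le_of_parityClass_mem Set.univ fun _ _ _ _ => trivial).trans ?_
  simp [Set.encard_univ, ENat.card_eq_coe_fintype_card]

/-- The three gap theorem: without a shift, the parity class of a gap vector is nonzero, as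
otherwise half of the vector would violate minimality. -/
lemma encard_gapVectorLengths_zero_le_three (α : ℝ) (N : ℕ) :
    (gapVectorLengths α 0 N).encard ≤ 3 := by
  refine (encard_gapVectorLengths_le_of_parityClass_mem {0}ᶜ ?_).trans ?_
  · intro k n hv h0 hpar
    have hN : |(0 : ℤ)| < N := by rw [abs_zero]; exact (abs_nonneg k).trans_lt hv.1
    have h := hv.abs_offset_le (n' := 0) hN (by simpa [parityClass] using hpar)
    simp only [offset, Int.cast_zero, zero_mul, add_zero, sub_zero, abs_zero] at h h0
    linarith
  · rw [Set.encard_eq_coe_toFinset_card]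
    exact le_of_eq (by decide)

/-! ### The two branches of the function -/

/-- The points `d * α` modulo `1`, `1 ≤ d ≤ N`, in `[0, κ)`. -/
def lowerBranch (κ α : ℝ) (N : ℕ) : Set ℝ :=
  {y | ∃ d n : ℤ, 1 ≤ d ∧ d ≤ N ∧ y = d * α + n ∧ 0 ≤ y ∧ y < κ}

/-- The points `d * α` modulo `1`, `1 ≤ d ≤ N`, in `[κ, 1)`, moved down by `β`. -/
def upperBranch (β κ α : ℝ) (N : ℕ) : Set ℝ :=
  {y | ∃ d n : ℤ, 1 ≤ d ∧ d ≤ N ∧ y + β = d * α + n ∧ κ ≤ y + β ∧ y + β < 1}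

lemma orbitValues_eq_union {β κ : ℝ}
    {f : ℝ → ℝ} (hper : Function.Periodic f 1)
    (hf₁ : ∀ x ∈ Set.Ico 0 κ, f x = x) (hf₂ : ∀ x ∈ Set.Ico κ 1, f x = x - β)
    (α : ℝ) (N : ℕ) :
    orbitValues f α N = lowerBranch κ α N ∪ upperBranch β κ α N := by
  have hshift : ∀ (x : ℝ) (n : ℤ), f (x + n) = f x := fun x n => by
    simpa using hper.int_mul n x
  ext y
  constructor
  · rintro ⟨d, h1, hN, rfl⟩
    have hfr : f (d * α) = f (Int.fract (d * α)) := by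
      rw [← hshift (d * α) (-⌊d * α⌋)]
      congr 1
      rw [Int.fract]; push_cast; ring
    have heq : Int.fract (d * α) = ((d : ℤ) : ℝ) * α + ((-⌊d * α⌋ : ℤ) : ℝ) := by
      rw [Int.fract]; push_cast; ring
    have h0 := Int.fract_nonneg (d * α)
    have hlt := Int.fract_lt_one (d * α)
    rcases lt_or_ge (Int.fract (d * α)) κ with h | h
    · left
      rw [hfr, hf₁ _ ⟨h0, h⟩]
      exact ⟨d, _, by exact_mod_cast h1, by exact_mod_cast hN, heq, h0, h⟩
    · right
      rw [hfr, hf₂ _ ⟨h, hlt⟩]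
      exact ⟨d, -⌊d * α⌋, by exact_mod_cast h1, by exact_mod_cast hN,
        by rw [sub_add_cancel]; exact heq, by simpa using h, by simpa using hlt⟩
  · rintro (⟨d, n, h1, hN, heq, h0, hlt⟩ | ⟨d, n, h1, hN, heq, h0, hlt⟩)
    · lift d to ℕ using by omega
      refine ⟨d, by omega, by omega, ?_⟩
      rw [← hshift _ n, ← hf₁ y ⟨h0, hlt⟩, heq, Int.cast_natCast]
    · lift d to ℕ using by omega
      refine ⟨d, by omega, by omega, ?_⟩
      have := hf₂ (y + β) ⟨h0, hlt⟩
      rw [← hshift _ n, ← Int.cast_natCast (R := ℝ) d, ← heq, this, add_sub_cancel_right]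

/-! ### Consecutive values -/

/-- `s < t` are consecutive elements of `S`. -/
def IsConsecutive (S : Set ℝ) (s t : ℝ) : Prop :=
  s ∈ S ∧ t ∈ S ∧ s < t ∧ ∀ u ∈ S, ¬ (s < u ∧ u < t)

/-- The lengths of the gaps of `S` between consecutive elements `s < t` with `s < c ≤ t`. -/
def gapLengthsAt (S : Set ℝ) (c : ℝ) : Set ℝ :=
  {g | ∃ s t, IsConsecutive S s t ∧ s < c ∧ c ≤ t ∧ g = t - s}

lemma encard_gapLengthsAt_le_one (S : Set ℝ) (c : ℝ) : (gapLengthsAt S c).encard ≤ 1 := by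
  rw [Set.encard_le_one_iff]
  rintro _ _ ⟨s, t, ⟨hs, ht, -, hst⟩, hsc, hct, rfl⟩ ⟨s', t', ⟨hs', ht', -, hst'⟩, hsc', hct', rfl⟩
  have h₁ : s = s' := by
    rcases lt_trichotomy s s' with h | h | h
    · exact absurd ⟨h, by linarith⟩ (hst s' hs')
    · exact h
    · exact absurd ⟨h, by linarith⟩ (hst' s hs)
  have h₂ : t = t' := by
    rcases lt_trichotomy t t' with h | h | h
    · exact absurd ⟨by linarith, h⟩ (hst' t ht)
    · exact h
    · exact absurd ⟨by linarith, h⟩ (hst t' ht')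
  rw [h₁, h₂]

/-- For indices `d, e` in `{1, …, N}` with `k = e - d` and a `k'` within `N / 2` of `k / 2`, moving
forward from `d` by `k'` or backward from `e` by `k'` leads to an index in `{1, …, N}` again. This
turns the minimality required of a gap vector into statements about orbit points in the gap. -/
lemma index_add_or_sub_mem {N : ℕ} {d e k' : ℤ} (hd : 1 ≤ d) (hdN : d ≤ N) (he : 1 ≤ e)
    (heN : e ≤ N) (hk : |2 * k' - (e - d)| < N) :
    (1 ≤ d + k' ∧ d + k' ≤ N) ∨ (1 ≤ e - k' ∧ e - k' ≤ N) := by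
  rw [abs_lt] at hk
  omega

lemma abs_index_sub_lt {N : ℕ} {d e : ℤ} (hd : 1 ≤ d) (hdN : d ≤ N) (he : 1 ≤ e)
    (heN : e ≤ N) : |e - d| < N := by
  rw [abs_lt]
  omega

/-- Let `p = d * α + m` and `q = e * α + n - γ` with indices `d, e` in `{1, …, N}`. If for no orbit
point `u` one of `u` and `u - γ` lies strictly between `p` and `q`, then the vector whose offset is
`q - p` is a gap vector. -/
lemma isGapVector_of_forall {α γ : ℝ} {N : ℕ} {d e m n : ℤ} (hd : 1 ≤ d) (hdN : d ≤ N)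
    (he : 1 ≤ e) (heN : e ≤ N)
    (h : ∀ i j : ℤ, 1 ≤ i → i ≤ N → ∀ w : ℝ, w = i * α + j ∨ w + γ = i * α + j →
      ¬ (d * α + m < w ∧ w < e * α + n - γ) ∧ ¬ (e * α + n - γ < w ∧ w < d * α + m)) :
    IsGapVector α γ N (e - d) (n - m) := by
  refine ⟨abs_index_sub_lt hd hdN he heN, fun k' n' hk' => ?_⟩
  rcases index_add_or_sub_mem hd hdN he heN hk' with ⟨h1, h2⟩ | ⟨h1, h2⟩
  · have := h (d + k') (m + n') h1 h2 (d * α + m + offset α γ k' n')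
      (Or.inr (by simp only [offset]; push_cast; ring))
    simp only [offset] at this ⊢
    push_cast at this ⊢
    exact ⟨fun hc => this.1 ⟨by linarith, by linarith⟩, fun hc => this.2 ⟨by linarith, by linarith⟩⟩
  · have := h (e - k') (n - n') h1 h2 (e * α + n - γ - offset α γ k' n')
      (Or.inl (by simp only [offset]; push_cast; ring))
    simp only [offset] at this ⊢
    push_cast at this ⊢
    exact ⟨fun hc => this.1 ⟨by linarith, by linarith⟩, fun hc => this.2 ⟨by linarith, by linarith⟩⟩

lemma sub_mem_gapVectorLengths_zero_of_lower {β κ α : ℝ} {N : ℕ} {s t : ℝ}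
    (hst : IsConsecutive (lowerBranch κ α N ∪ upperBranch β κ α N) s t)
    (hs : s ∈ lowerBranch κ α N) (ht : t ∈ lowerBranch κ α N) :
    t - s ∈ gapVectorLengths α 0 N := by
  obtain ⟨-, -, hlt, hno⟩ := hst
  obtain ⟨d, m, hd, hdN, hs, hs0, -⟩ := hs
  obtain ⟨e, n, he, heN, ht, -, htκ⟩ := ht
  refine ⟨sub_pos.mpr hlt, e - d, n - m, isGapVector_of_forall hd hdN he heN ?_, ?_⟩
  · intro i j hi hiN w hw
    rw [add_zero, or_self] at hw
    rw [← hs, ← ht, sub_zero]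
    refine ⟨fun hc => ?_, fun hc => by linarith [hc.1, hc.2]⟩
    exact hno w (Or.inl ⟨i, j, hi, hiN, hw, by linarith [hc.1], by linarith [hc.2]⟩) hc
  · rw [← abs_of_pos (sub_pos.mpr hlt), hs, ht, offset]
    congr 1
    push_cast; ring

lemma sub_mem_gapVectorLengths_zero_of_upper {β κ α : ℝ} {N : ℕ} {s t : ℝ}
    (hst : IsConsecutive (lowerBranch κ α N ∪ upperBranch β κ α N) s t)
    (hs : s ∈ upperBranch β κ α N) (ht : t ∈ upperBranch β κ α N) :
    t - s ∈ gapVectorLengths α 0 N := by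
  obtain ⟨-, -, hlt, hno⟩ := hst
  obtain ⟨d, m, hd, hdN, hs, hsκ, -⟩ := hs
  obtain ⟨e, n, he, heN, ht, -, ht1⟩ := ht
  refine ⟨sub_pos.mpr hlt, e - d, n - m, isGapVector_of_forall hd hdN he heN ?_, ?_⟩
  · intro i j hi hiN w hw
    rw [add_zero, or_self] at hw
    rw [← hs, ← ht, sub_zero]
    refine ⟨fun hc => ?_, fun hc => by linarith [hc.1, hc.2]⟩
    exact hno (w - β) (Or.inr ⟨i, j, hi, hiN, by rw [sub_add_cancel]; exact hw,
      by linarith [hc.1], by linarith [hc.2]⟩) ⟨by linarith [hc.1], by linarith [hc.2]⟩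
  · rw [← abs_of_pos (sub_pos.mpr hlt), offset]
    congr 1
    push_cast; linarith

/-- Between a lower value `s ≥ κ - β` and an upper value `t < κ`, every orbit point is seen by the
lower branch and every orbit point moved down by `β` by the upper one. -/
lemma sub_mem_gapVectorLengths_of_lower_upper {β κ α : ℝ} {N : ℕ} {s t : ℝ}
    (hst : IsConsecutive (lowerBranch κ α N ∪ upperBranch β κ α N) s t)
    (hs : s ∈ lowerBranch κ α N) (ht : t ∈ upperBranch β κ α N)
    (hsκ : κ - β ≤ s) (htκ : t < κ) :
    t - s ∈ gapVectorLengths α β N := by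
  obtain ⟨-, -, hlt, hno⟩ := hst
  obtain ⟨d, m, hd, hdN, hs, hs0, -⟩ := hs
  obtain ⟨e, n, he, heN, ht, -, ht1⟩ := ht
  refine ⟨sub_pos.mpr hlt, e - d, n - m, isGapVector_of_forall hd hdN he heN ?_, ?_⟩
  · intro i j hi hiN w hw
    rw [← hs, ← ht, add_sub_cancel_right]
    refine ⟨fun hc => hno w ?_ hc, fun hc => by linarith [hc.1, hc.2]⟩
    rcases hw with hw | hw
    · exact Or.inl ⟨i, j, hi, hiN, hw, by linarith [hc.1], by linarith [hc.2]⟩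
    · exact Or.inr ⟨i, j, hi, hiN, hw, by linarith [hc.1], by linarith [hc.2]⟩
  · rw [← abs_of_pos (sub_pos.mpr hlt), offset]
    congr 1
    push_cast; linarith

lemma sub_mem_gapVectorLengths_of_upper_lower {β κ α : ℝ} (hβκ : β ≤ κ) {N : ℕ} {s t : ℝ}
    (hst : IsConsecutive (lowerBranch κ α N ∪ upperBranch β κ α N) s t)
    (hs : s ∈ upperBranch β κ α N) (ht : t ∈ lowerBranch κ α N) (htβ : t < 1 - β) :
    t - s ∈ gapVectorLengths α β N := by
  obtain ⟨-, -, hlt, hno⟩ := hst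
  obtain ⟨e, n, he, heN, hs, hsκ, -⟩ := hs
  obtain ⟨d, m, hd, hdN, ht, -, htκ⟩ := ht
  refine ⟨sub_pos.mpr hlt, e - d, n - m, isGapVector_of_forall hd hdN he heN ?_, ?_⟩
  · intro i j hi hiN w hw
    rw [← hs, ← ht, add_sub_cancel_right]
    refine ⟨fun hc => by linarith [hc.1, hc.2], fun hc => hno w ?_ hc⟩
    rcases hw with hw | hw
    · exact Or.inl ⟨i, j, hi, hiN, hw, by linarith [hc.1], by linarith [hc.2]⟩
    · exact Or.inr ⟨i, j, hi, hiN, hw, by linarith [hc.1], by linarith [hc.2]⟩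
  · rw [← abs_of_pos (sub_pos.mpr hlt), ← abs_neg (t - s), offset]
    congr 1
    push_cast; linarith

/-- Every gap comes from a gap vector unless it contains one of two levels. A gap between different
branches escapes the previous lemmas at `κ` only if `κ < 1 - β`, and at `1 - β` only if
`1 - β < κ`, so that together with `κ - β` the single level `min κ (1 - β)` suffices. -/
lemma sub_mem_of_isConsecutive {β κ α : ℝ} (hβκ : β ≤ κ) {N : ℕ} {s t : ℝ}
    (hst : IsConsecutive (lowerBranch κ α N ∪ upperBranch β κ α N) s t) :
    t - s ∈ gapVectorLengths α 0 N ∪ gapVectorLengths α β N ∪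
      gapLengthsAt (lowerBranch κ α N ∪ upperBranch β κ α N) (κ - β) ∪
      gapLengthsAt (lowerBranch κ α N ∪ upperBranch β κ α N) (min κ (1 - β)) := by
  rcases hst.1 with hs | hs <;> rcases hst.2.1 with ht | ht
  · exact Or.inl (Or.inl (Or.inl (sub_mem_gapVectorLengths_zero_of_lower hst hs ht)))
  · rcases lt_or_ge s (κ - β) with h | h
    · obtain ⟨e, n, -, -, -, htκ, -⟩ := ht
      exact Or.inl (Or.inr ⟨s, t, hst, h, by linarith, rfl⟩)
    rcases lt_or_ge t κ with h' | h'
    · exact Or.inl (Or.inl (Or.inr (sub_mem_gapVectorLengths_of_lower_upper hst hs ht h h')))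
    · obtain ⟨e, n, -, -, -, -, ht1⟩ := ht
      obtain ⟨d, m, -, -, -, -, hsκ⟩ := hs
      exact Or.inr ⟨s, t, hst, lt_min hsκ (by linarith), min_le_of_left_le h', rfl⟩
  · rcases lt_or_ge t (1 - β) with h | h
    · exact Or.inl (Or.inl (Or.inr (sub_mem_gapVectorLengths_of_upper_lower hβκ hst hs ht h)))
    · obtain ⟨e, n, -, -, -, -, hs1⟩ := hs
      obtain ⟨d, m, -, -, -, -, htκ⟩ := ht
      exact Or.inr ⟨s, t, hst, lt_min (hst.2.2.1.trans htκ) (by linarith),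
        min_le_of_right_le h, rfl⟩
  · exact Or.inl (Or.inl (Or.inl (sub_mem_gapVectorLengths_zero_of_upper hst hs ht)))

theorem mainTheorem5 (β κ : ℝ) (hβ : 0 < β) (hβκ : β ≤ κ) (hκ : κ < 1)
    (f : ℝ → ℝ) (hper : Function.Periodic f 1)
    (hf₁ : ∀ x ∈ Set.Ico 0 κ, f x = x)
    (hf₂ : ∀ x ∈ Set.Ico κ 1, f x = x - β)
    (α : ℝ) (N : ℕ) :
    (gapLengthSet f α N).encard ≤ 10 := by
  have hS := orbitValues_eq_union hper hf₁ hf₂ α N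
  have hwrap : {g | ∃ s t : ℝ, IsLeast (orbitValues f α N) s ∧ IsGreatest (orbitValues f α N) t ∧
      g = s - sInf (Set.range f) + sSup (Set.range f) - t}.encard ≤ 1 := by
    rw [Set.encard_le_one_iff]
    rintro _ _ ⟨s, t, hs, ht, rfl⟩ ⟨s', t', hs', ht', rfl⟩
    rw [hs.unique hs', ht.unique ht']
  have hinner : {g | ∃ s ∈ orbitValues f α N, ∃ t ∈ orbitValues f α N, s < t ∧
      (∀ u ∈ orbitValues f α N, ¬(s < u ∧ u < t)) ∧ g = t - s}.encard ≤ 3 + 4 + 1 + 1 := by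
    rw [hS]
    refine (Set.encard_le_encard (t := gapVectorLengths α 0 N ∪ gapVectorLengths α β N ∪
      gapLengthsAt (lowerBranch κ α N ∪ upperBranch β κ α N) (κ - β) ∪
      gapLengthsAt (lowerBranch κ α N ∪ upperBranch β κ α N) (min κ (1 - β))) ?_).trans ?_
    · rintro _ ⟨s, hs, t, ht, hlt, hno, rfl⟩
      exact sub_mem_of_isConsecutive hβκ ⟨hs, ht, hlt, hno⟩
    · refine (Set.encard_union_le _ _).trans (add_le_add ?_ (encard_gapLengthsAt_le_one _ _))
      refine (Set.encard_union_le _ _).trans (add_le_add ?_ (encard_gapLengthsAt_le_one _ _))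
      exact (Set.encard_union_le _ _).trans (add_le_add (encard_gapVectorLengths_zero_le_three _ _)
        (encard_gapVectorLengths_le_four _ _ _))
  refine (Set.encard_union_le _ _).trans ((add_le_add hwrap hinner).trans ?_)
  norm_num
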